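/- Let $\mathbb D=\{z\in\mathbb C:|z|<1\}$, let $(a_n)_{n\ge0}$ and $(b_n)_{n\ge0}$ be sequences of complex numbers with $a_n\neq 0$ for all $n$, and put $f_n(z)=(a_n+b_nz)z^n$ for $z\in\mathbb D$, $n\ge 0$. Let $\mathcal H_k$ be a reproducing kernel Hilbert space of complex-valued functions on $\mathbb D$ (a Hilbert space of functions on $\mathbb D$ with bounded point evaluations) having $\{f_n\}_{n\ge 0}$ as an orthonormal basis; thus its kernel is $k(z,w)=\sum_{n=0}^\infty f_n(z)\overline{f_n(w)}$. Assume that $$\inf_{n\ge0}\left|\frac{a_n}{a_{n+1}}\right|>0,\qquad \sup_{n\ge0}\left|\frac{a_n}{a_{n+1}}\right|<\infty,\qquad \limsup_{n\to\infty}\left|\frac{b_n}{a_{n+1}}\right|<1 .$$ Then multiplication by the coordinate function, $(M_zf)(z)=zf(z)$, defines a bounded linear operator $M_z$ on $\mathcal H_k$, which is left-invertible (that is, $LM_z=I$ for some bounded linear operator $L$ on $\mathcal H_k$). Moreover, $M_z=K+V$ for some compact operator $K$ and some linear isometry $V$ on $\mathcal H_k$ if and only if $$\left|\frac{a_n}{a_{n+1}}\right|\to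 1\qquad\text{and}\qquad \left|\frac{b_n}{a_n}-\frac{b_{n+1}}{a_{n+1}}\right|\to 0\qquad (n\to\infty).$$ -/

import Mathlib

open Filter Topology
open scoped Complex.UnitDisc

/-- The functions `f_n(z) = (a_n + b_n z) z ^ n` on the open unit disc. -/
def tridiagonalFun (a b : ℕ → ℂ) (n : ℕ) (z : 𝔻) : ℂ :=
  (a n + b n * (z : ℂ)) * (z : ℂ) ^ n

/-- The bounded operator `M` on the reproducing kernel Hilbert space `H` of complex functions on
the open unit disc is the operator of multiplication by the coordinate function:
`(M f)(z) = z f(z)`. There is at most one such `M`, as elements of `H` are determined by their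
values. -/
def IsCoordinateShift {H : Type*} [NormedAddCommGroup H] [InnerProductSpace ℂ H]
    [RKHS ℂ H 𝔻 ℂ] (M : H →L[ℂ] H) : Prop :=
  ∀ (f : H) (z : 𝔻), (M f) z = (z : ℂ) * f z

/-- `T` is left-invertible in the algebra of bounded operators. -/
def IsLeftInvertible {H : Type*} [NormedAddCommGroup H] [InnerProductSpace ℂ H]
    (T : H →L[ℂ] H) : Prop :=
  ∃ L : H →L[ℂ] H, L ∘L T = ContinuousLinearMap.id ℂ H

/-- `T = K + V` with `K` a compact operator and `V` a (not necessarily surjective) linear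
isometry. -/
def IsCompactPlusIsometry {H : Type*} [NormedAddCommGroup H] [InnerProductSpace ℂ H]
    (T : H →L[ℂ] H) : Prop :=
  ∃ (K : H →L[ℂ] H) (V : H →ₗᵢ[ℂ] H), IsCompactOperator K ∧ T = K + V.toContinuousLinearMap

/-! Put `c n = b n / a (n+1)`, `α n = a n / a (n+1)` and `g n = a n * z ^ n`. Then `f n = g n + c n
• g (n+1)`, and multiplication by `z` sends `g n` to `α n • g (n+1)`. For the weighted shift `W : e
n ↦ c n • e (n+1)`, `1 + W` is invertible (`isUnit_one_add_weightedShift`). Its inverse `B` has `B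
(e n) = g n` (`rieszBasis_apply_eq`), so the `g n` form a Riesz basis and `M_z` is similar to the
shift with weights `α`, hence bounded and left-invertible.

In the orthonormal basis, `M (e n) = α n • e (n+1) + β n • g (n+2)` with `β n = α n * α (n+1) * (b n
/ a n - b (n+1) / a (n+1))`. If `|α n| → 1` and `β n → 0`, then `M` differs by a compact operator
from the shift with unimodular weights `α n / |α n|`. Conversely, a compact perturbation of an
isometry asymptotically preserves inner products along `e n` and `g (n+1)`; as `e n ⟂ g (n+1)`, this
forces `β n → 0`, and then `|α n| → 1`. -/

/-! ### Diagonal operators on `ℓ²`. -/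

theorem lp.norm_mul_apply_le_norm_smul_apply {w : ℕ → ℂ} {C : ℝ} (hC : ∀ n, ‖w n‖ ≤ C)
    (x : lp (fun _ : ℕ => ℂ) 2) (n : ℕ) :
    ‖w n * x n‖ ≤ ‖(((C : ℂ) • x : lp (fun _ : ℕ => ℂ) 2)) n‖ := by
  have hC0 : 0 ≤ C := (norm_nonneg _).trans (hC 0)
  simp only [lp.coeFn_smul, Pi.smul_apply, norm_smul, Complex.norm_real,
    Real.norm_of_nonneg hC0, norm_mul]
  exact mul_le_mul_of_nonneg_right (hC n) (norm_nonneg _)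

/-- Multiplication of `ℓ²` sequences by a bounded sequence, as a linear map. -/
def lpDiagonalₗ (w : ℕ → ℂ) (C : ℝ) (hC : ∀ n, ‖w n‖ ≤ C) :
    lp (fun _ : ℕ => ℂ) 2 →ₗ[ℂ] lp (fun _ : ℕ => ℂ) 2 where
  toFun x := ⟨fun n => w n * x n,
    (lp.memℓp ((C : ℂ) • x)).mono' (lp.norm_mul_apply_le_norm_smul_apply hC x)⟩
  map_add' x y := by
    ext n
    exact mul_add _ _ _
  map_smul' r x := by
    ext n
    exact mul_left_comm _ _ _

theorem norm_lpDiagonalₗ_apply_le (w : ℕ → ℂ) (C : ℝ) (hC : ∀ n, ‖w n‖ ≤ C)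
    (x : lp (fun _ : ℕ => ℂ) 2) : ‖lpDiagonalₗ w C hC x‖ ≤ C * ‖x‖ := by
  have hC0 : 0 ≤ C := (norm_nonneg _).trans (hC 0)
  refine (lp.norm_mono two_ne_zero (lp.norm_mul_apply_le_norm_smul_apply hC x)).trans ?_
  rw [norm_smul, Complex.norm_real, Real.norm_of_nonneg hC0]

/-- The diagonal operator on `ℓ²` with a bounded sequence of diagonal entries. -/
noncomputable def lpDiagonal (w : ℕ → ℂ) (C : ℝ) (hC : ∀ n, ‖w n‖ ≤ C) :
    lp (fun _ : ℕ => ℂ) 2 →L[ℂ] lp (fun _ : ℕ => ℂ) 2 :=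
  (lpDiagonalₗ w C hC).mkContinuous C (norm_lpDiagonalₗ_apply_le w C hC)

theorem norm_lpDiagonal_le (w : ℕ → ℂ) (C : ℝ) (hC : ∀ n, ‖w n‖ ≤ C) : ‖lpDiagonal w C hC‖ ≤ C :=
  LinearMap.mkContinuous_norm_le _ ((norm_nonneg _).trans (hC 0)) _

/-! ### Operators and compactness relative to a Hilbert basis. -/

section HilbertBasis

variable {H : Type*} [NormedAddCommGroup H] [InnerProductSpace ℂ H]

/-- Bounded operators agreeing on a Hilbert basis are equal. -/
theorem HilbertBasis.clm_ext {F : Type*} [TopologicalSpace F] [T2Space F] [AddCommMonoid F]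
    [Module ℂ F] (e : HilbertBasis ℕ ℂ H) {S T : H →L[ℂ] F} (h : ∀ n, S (e n) = T (e n)) :
    S = T := by
  refine ContinuousLinearMap.ext_on (s := Set.range e)
    (Submodule.dense_iff_topologicalClosure_eq_top.mpr e.dense_span) ?_
  rintro _ ⟨n, rfl⟩
  exact h n

/-- The coefficients of a vector against an orthonormal sequence tend to zero. -/
theorem Orthonormal.tendsto_inner_zero {v : ℕ → H} (hv : Orthonormal ℂ v) (x : H) :
    Tendsto (fun n => inner ℂ x (v n)) atTop (𝓝 0) := by
  have h := (hv.inner_products_summable (x := x)).tendsto_atTop_zero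
  rw [tendsto_zero_iff_norm_tendsto_zero]
  have := h.sqrt
  simpa [Real.sqrt_sq, norm_inner_symm] using this

variable [CompleteSpace H]

/-- An orthonormal sequence is the image of a Hilbert basis under an isometry. -/
theorem HilbertBasis.exists_linearIsometry (e : HilbertBasis ℕ ℂ H) {v : ℕ → H}
    (hv : Orthonormal ℂ v) : ∃ V : H →ₗᵢ[ℂ] H, ∀ n, V (e n) = v n := by
  refine ⟨hv.orthogonalFamily.linearIsometry.comp e.repr.toLinearIsometry, fun n => ?_⟩
  simp [e.repr_self]

/-- A bounded weight sequence and an orthonormal sequence define a bounded operator. -/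
theorem HilbertBasis.exists_clm (e : HilbertBasis ℕ ℂ H) {v : ℕ → H} (hv : Orthonormal ℂ v)
    {w : ℕ → ℂ} {C : ℝ} (hC : ∀ n, ‖w n‖ ≤ C) :
    ∃ T : H →L[ℂ] H, (∀ n, T (e n) = w n • v n) ∧ ‖T‖ ≤ C := by
  have hC0 : 0 ≤ C := (norm_nonneg _).trans (hC 0)
  refine ⟨hv.orthogonalFamily.linearIsometry.toContinuousLinearMap ∘L lpDiagonal w C hC ∘L
    e.repr.toLinearIsometry.toContinuousLinearMap, fun n => ?_, ?_⟩
  · have : lpDiagonal w C hC (lp.single 2 n (1 : ℂ)) = lp.single 2 n (w n) := by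
      ext m
      rcases eq_or_ne m n with rfl | h
      · simp [lpDiagonal, lpDiagonalₗ]
      · simp [lpDiagonal, lpDiagonalₗ, lp.single_apply, h]
    simp [e.repr_self, this]
  · refine ContinuousLinearMap.opNorm_le_bound _ hC0 fun x => ?_
    simp only [ContinuousLinearMap.comp_apply, LinearIsometry.coe_toContinuousLinearMap,
      LinearIsometry.norm_map]
    refine (ContinuousLinearMap.le_of_opNorm_le _ (norm_lpDiagonal_le w C hC) _).trans ?_
    simp

/-- An operator sending a Hilbert basis to a null multiple of an orthonormal sequence is
compact. -/
theorem HilbertBasis.isCompactOperator_of_tendsto_zero (e : HilbertBasis ℕ ℂ H) {v : ℕ → H}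
    (hv : Orthonormal ℂ v) {w : ℕ → ℂ} (hw : Tendsto w atTop (𝓝 0)) {T : H →L[ℂ] H}
    (hT : ∀ n, T (e n) = w n • v n) : IsCompactOperator T := by
  let F : ℕ → H →L[ℂ] H := fun N =>
    ∑ i ∈ Finset.range N, (ContinuousLinearMap.toSpanSingleton ℂ (w i • v i)) ∘L innerSL ℂ (e i)
  have hFe (N n : ℕ) : F N (e n) = if n < N then w n • v n else 0 := by
    simp only [F, sum_apply, ContinuousLinearMap.comp_apply, innerSL_apply_apply,
      orthonormal_iff_ite.1 e.orthonormal, ContinuousLinearMap.toSpanSingleton_apply, ite_smul,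
      one_smul, zero_smul]
    simp
  have hF : Tendsto F atTop (𝓝 T) := by
    rw [Metric.tendsto_atTop]
    intro ε hε
    obtain ⟨N₀, hN₀⟩ := Metric.tendsto_atTop.1 hw (ε / 2) (half_pos hε)
    refine ⟨N₀, fun N hN => ?_⟩
    -- The remainder `T - F N` has these weights, so `exists_clm` bounds its norm by `ε / 2`.
    have hb (n : ℕ) : ‖if n < N then 0 else w n‖ ≤ ε / 2 := by
      split_ifs with h
      · simpa using (half_pos hε).le
      · simpa using (hN₀ n (hN.trans (not_lt.1 h))).le
    obtain ⟨R, hR, hRn⟩ := e.exists_clm hv hb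
    have : T - F N = R := e.clm_ext fun n => by
      rw [sub_apply, hT, hFe, hR]
      split_ifs <;> simp
    rw [dist_comm, dist_eq_norm, this]
    linarith
  refine isCompactOperator_of_tendsto hF (Eventually.of_forall fun N => ?_)
  have : F N ∈ compactOperator (RingHom.id ℂ) H H := by
    refine Submodule.sum_mem _ fun i _ => ?_
    exact (isCompactOperator_of_locallyCompactSpace_dom (innerSL ℂ (e i))).clm_comp
      (ContinuousLinearMap.toSpanSingleton ℂ (w i • v i))
  exact this

/-- A compact operator maps orthonormal sequences to null sequences. -/
theorem IsCompactOperator.tendsto_orthonormal {K : H →L[ℂ] H} (hK : IsCompactOperator K)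
    {v : ℕ → H} (hv : Orthonormal ℂ v) : Tendsto (fun n => K (v n)) atTop (𝓝 0) := by
  obtain ⟨s, hs, hKs⟩ := hK.image_closedBall_subset_compact 1
  refine hs.tendsto_nhds_of_unique_mapClusterPt
    (Eventually.of_forall fun n => hKs ⟨v n, by simp [hv.1 n], rfl⟩) fun y _ hy => ?_
  -- `K (v n)` is weakly null, so its only possible cluster point is zero.
  have h2 : Tendsto (fun n => inner ℂ y (K (v n))) atTop (𝓝 0) := by
    simpa [ContinuousLinearMap.adjoint_inner_left] using hv.tendsto_inner_zero (K.adjoint y)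
  obtain ⟨φ, hφ, hy⟩ := hy.tendsto_subseq
  have h1 : Tendsto (fun n => inner ℂ y (K (v (φ n)))) atTop (𝓝 (inner ℂ y y)) :=
    tendsto_const_nhds.inner hy
  exact inner_self_eq_zero.1 (tendsto_nhds_unique h1 (h2.comp hφ.tendsto_atTop))

end HilbertBasis

/-- A bounded solution of `h n = -c n * h (n + 1)` vanishes if `c` is eventually a contraction. -/
theorem eq_zero_of_bounded_backward_recursion {c h : ℕ → ℂ} {ρ C : ℝ} (hρ : ρ < 1)
    (hc : ∀ᶠ n in atTop, ‖c n‖ ≤ ρ) (hb : ∀ n, ‖h n‖ ≤ C)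
    (hr : ∀ n, h n = -c n * h (n + 1)) (n : ℕ) : h n = 0 := by
  obtain ⟨N, hN⟩ := eventually_atTop.1 hc
  have hρ0 : 0 ≤ ρ := (norm_nonneg _).trans (hN N le_rfl)
  have hpow (k : ℕ) : ∀ n ≥ N, ‖h n‖ ≤ ρ ^ k * C := by
    induction k with
    | zero => simpa using fun n _ => hb n
    | succ k ih =>
      intro n hn
      rw [hr n, norm_mul, norm_neg, pow_succ', mul_assoc]
      exact mul_le_mul (hN n hn) (ih (n + 1) (by omega)) (norm_nonneg _) hρ0
  have htail (n : ℕ) (hn : N ≤ n) : h n = 0 := by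
    have ht : Tendsto (fun k : ℕ => ρ ^ k * C) atTop (𝓝 0) := by
      simpa using (tendsto_pow_atTop_nhds_zero_of_lt_one hρ0 hρ).mul_const C
    exact norm_le_zero_iff.1 (ge_of_tendsto' ht fun k => hpow k n hn)
  have hback (k : ℕ) : ∀ n, N ≤ n + k → h n = 0 := by
    induction k with
    | zero => simpa using htail
    | succ k ih => exact fun n hn => by rw [hr n, ih (n + 1) (by omega), mul_zero]
  exact hback N n (by omega)

theorem exists_norm_le_of_eventually {E : Type*} [Norm E] {c : ℕ → E} {ρ : ℝ}
    (hc : ∀ᶠ n in atTop, ‖c n‖ ≤ ρ) : ∃ C : ℝ, ∀ n, ‖c n‖ ≤ C := by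
  obtain ⟨C, hC⟩ := (isBoundedUnder_of_eventually_le hc).bddAbove_range
  exact ⟨C, fun n => hC ⟨n, rfl⟩⟩

/-! ### Weighted shifts on a Riesz basis. -/

section WeightedShift

variable {H : Type*} [NormedAddCommGroup H] [InnerProductSpace ℂ H]

variable {e : HilbertBasis ℕ ℂ H} {c α : ℕ → ℂ} {M B : H →L[ℂ] H}

/-- The action on the orthonormal basis of a weighted shift with respect to the Riesz basis. -/
theorem apply_basis_of_shift_rieszBasis
    (hB : ∀ n, B (e n) + c n • B (e (n + 1)) = e n)
    (hM : ∀ n, M (B (e n)) = α n • B (e (n + 1))) (n : ℕ) :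
    M (e n) = α n • e (n + 1) + (c n * α (n + 1) - α n * c (n + 1)) • B (e (n + 2)) := by
  conv_lhs => rw [← hB n]
  rw [map_add, map_smul, hM, hM, eq_sub_of_add_eq (hB (n + 1))]
  module

/-- Pairing `hB` with `e m` gives a bounded backward recursion beyond index `m`, which has only the
zero solution. -/
theorem inner_rieszBasis_eq_zero {ρ : ℝ} (hρ : ρ < 1) (hc : ∀ᶠ n in atTop, ‖c n‖ ≤ ρ)
    (hB : ∀ n, B (e n) + c n • B (e (n + 1)) = e n) (m : ℕ) :
    inner ℂ (e m) (B (e (m + 1))) = 0 := by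
  refine eq_zero_of_bounded_backward_recursion (c := fun j => c (m + 1 + j))
    (h := fun j => inner ℂ (e m) (B (e (m + 1 + j)))) (C := ‖B‖) hρ ?_ (fun j => ?_)
    (fun j => ?_) 0
  · exact (tendsto_add_atTop_nat (m + 1)).eventually hc |>.mono fun j hj => by rwa [add_comm]
  · refine (norm_inner_le_norm _ _).trans ?_
    simpa [e.orthonormal.1] using B.le_opNorm (e (m + 1 + j))
  · have h : inner ℂ (e m) (e (m + 1 + j)) = 0 := e.orthonormal.2 (by omega)
    rw [← hB (m + 1 + j), inner_add_right, inner_smul_right] at h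
    linear_combination h

theorem one_le_norm_rieszBasis {ρ : ℝ} (hρ : ρ < 1) (hc : ∀ᶠ n in atTop, ‖c n‖ ≤ ρ)
    (hB : ∀ n, B (e n) + c n • B (e (n + 1)) = e n) (n : ℕ) : 1 ≤ ‖B (e n)‖ := by
  have h : inner ℂ (e n) (e n) = (1 : ℂ) := by simp [e.orthonormal.1]
  nth_rewrite 2 [← hB n] at h
  rw [inner_add_right, inner_smul_right, inner_rieszBasis_eq_zero hρ hc hB, mul_zero,
    add_zero] at h
  have := norm_inner_le_norm (𝕜 := ℂ) (e n) (B (e n))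
  simpa [h, e.orthonormal.1] using this

/-- A compact perturbation `M` of an isometry asymptotically preserves inner products of bounded
sequences whose images under the compact part are null. -/
theorem tendsto_inner_sub_inner {K : H →L[ℂ] H} {V : H →ₗᵢ[ℂ] H} {x y : ℕ → H} {Cx Cy : ℝ}
    (hM : M = K + V.toContinuousLinearMap) (hx : ∀ n, ‖x n‖ ≤ Cx) (hy : ∀ n, ‖y n‖ ≤ Cy)
    (hKx : Tendsto (fun n => K (x n)) atTop (𝓝 0)) (hKy : Tendsto (fun n => K (y n)) atTop (𝓝 0)) :
    Tendsto (fun n => inner ℂ (M (x n)) (M (y n)) - inner ℂ (x n) (y n)) atTop (𝓝 0) := by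
  have h (n : ℕ) : inner ℂ (M (x n)) (M (y n)) - inner ℂ (x n) (y n) =
      inner ℂ (K (x n)) (M (y n)) + inner ℂ (V (x n)) (K (y n)) := by
    have hMx (z : H) : M z = K z + V z := by rw [hM]; rfl
    rw [hMx (x n), inner_add_left, hMx (y n), inner_add_right (V _), V.inner_map_map]
    ring
  refine squeeze_zero_norm (a := fun n => ‖K (x n)‖ * (‖M‖ * Cy) + Cx * ‖K (y n)‖) (fun n => ?_) ?_
  · rw [h]
    refine (norm_add_le _ _).trans (add_le_add ?_ ?_)
    · refine (norm_inner_le_norm _ _).trans (mul_le_mul_of_nonneg_left ?_ (norm_nonneg _))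
      exact (M.le_opNorm _).trans (mul_le_mul_of_nonneg_left (hy n) (norm_nonneg _))
    · refine (norm_inner_le_norm _ _).trans (mul_le_mul_of_nonneg_right ?_ (norm_nonneg _))
      rw [V.norm_map]
      exact hx n
  · simpa using (hKx.norm.mul_const (‖M‖ * Cy)).add (hKy.norm.const_mul Cx)

variable [CompleteSpace H]

/-- `1 + W` is invertible for a weighted shift `W` whose weights are eventually bounded by some
`ρ < 1`: conjugating by a diagonal operator turns `W` into a strict contraction. -/
theorem HilbertBasis.isUnit_one_add_weightedShift (e : HilbertBasis ℕ ℂ H) {c : ℕ → ℂ} {ρ : ℝ}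
    (hρ0 : 0 < ρ) (hρ : ρ < 1) (hc : ∀ᶠ n in atTop, ‖c n‖ ≤ ρ) {W : H →L[ℂ] H}
    (hW : ∀ n, W (e n) = c n • e (n + 1)) : IsUnit (1 + W) := by
  obtain ⟨N, hN⟩ := eventually_atTop.1 hc
  obtain ⟨C, hC⟩ := exists_norm_le_of_eventually hc
  -- Chosen so that `t * C ≤ ρ`; the maximum with `1` ensures `t ≤ 1`.
  set t : ℝ := ρ / max C 1 with ht
  have hm : 0 < max C 1 := lt_max_of_lt_right one_pos
  have ht0 : 0 < t := div_pos hρ0 hm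
  have ht1 : t ≤ 1 := (div_le_one hm).2 (hρ.le.trans (le_max_right _ _))
  have htC : t * max C 1 = ρ := div_mul_cancel₀ _ hm.ne'
  have htne : (t : ℂ) ≠ 0 := by exact_mod_cast ht0.ne'
  -- Conjugation by this diagonal multiplies the `n`-th weight by `p (n+1) / p n`: `t` below `N`,
  -- and `1` from `N` on.
  let p : ℕ → ℂ := fun n => (t : ℂ) ^ min n N
  have hp0 (n : ℕ) : p n ≠ 0 := pow_ne_zero _ htne
  have hpn (n : ℕ) : ‖p n‖ = t ^ min n N := by
    simp [p, abs_of_pos ht0]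
  have hp (n : ℕ) : ‖p n‖ ≤ 1 := by
    rw [hpn]
    exact pow_le_one₀ ht0.le ht1
  have hpi (n : ℕ) : ‖(p n)⁻¹‖ ≤ (t ^ N)⁻¹ := by
    rw [norm_inv, hpn]
    exact inv_anti₀ (pow_pos ht0 _) (pow_le_pow_of_le_one ht0.le ht1 (min_le_right _ _))
  let w : ℕ → ℂ := fun n => if n < N then t * c n else c n
  have hw (n : ℕ) : ‖w n‖ ≤ ρ := by
    simp only [w]
    split_ifs with h
    · rw [norm_mul, Complex.norm_real, Real.norm_of_nonneg ht0.le, ← htC]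
      exact mul_le_mul_of_nonneg_left ((hC n).trans (le_max_left _ _)) ht0.le
    · exact hN n (not_lt.1 h)
  obtain ⟨D, hD, -⟩ := e.exists_clm e.orthonormal hp
  obtain ⟨D', hD', -⟩ := e.exists_clm e.orthonormal hpi
  obtain ⟨W', hW', hW'n⟩ :=
    e.exists_clm (e.orthonormal.comp _ (add_left_injective 1)) hw
  have hDD' : D * D' = 1 := e.clm_ext fun n => by
    simp [hD, hD', smul_smul, hp0]
  have hD'D : D' * D = 1 := e.clm_ext fun n => by
    simp [hD, hD', smul_smul, hp0]
  have hcomm : D * W = W' * D := e.clm_ext fun n => by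
    change D (W (e n)) = W' (D (e n))
    simp only [hW, hD, map_smul, hW', smul_smul, Function.comp_apply]
    congr 1
    simp only [p, w]
    split_ifs with h
    · rw [min_eq_left (by omega), min_eq_left (by omega), pow_succ]
      ring
    · rw [min_eq_right (by omega), min_eq_right (by omega), mul_comm]
  have hW'u : IsUnit (1 + W') := by
    have := isUnit_one_sub_of_norm_lt_one (x := -W') (by rw [norm_neg]; linarith)
    rwa [sub_neg_eq_add] at this
  have hDu : IsUnit D := ⟨⟨D, D', hDD', hD'D⟩, rfl⟩
  have hD'u : IsUnit D' := ⟨⟨D', D, hD'D, hDD'⟩, rfl⟩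
  have : 1 + W = D' * (1 + W') * D := by
    rw [mul_add, add_mul, mul_one, hD'D, mul_assoc, ← hcomm, ← mul_assoc, hD'D, one_mul]
  rw [this]
  exact (hD'u.mul hW'u).mul hDu

/-- There is a bounded left-invertible weighted shift with weights `α` with respect to the Riesz
basis `B (e n)` determined by `B (e n) + c n • B (e (n + 1)) = e n`. -/
theorem HilbertBasis.exists_shift_rieszBasis (e : HilbertBasis ℕ ℂ H) {c α : ℕ → ℂ}
    {ρ ε C : ℝ} (hρ0 : 0 < ρ) (hρ : ρ < 1) (hc : ∀ᶠ n in atTop, ‖c n‖ ≤ ρ) (hε : 0 < ε)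
    (hlow : ∀ n, ε ≤ ‖α n‖) (hupp : ∀ n, ‖α n‖ ≤ C) :
    ∃ M B T : H →L[ℂ] H, (∀ n, B (e n) + c n • B (e (n + 1)) = e n) ∧
      (∀ n, M (B (e n)) = α n • B (e (n + 1))) ∧ B * T = 1 ∧ IsLeftInvertible M := by
  have hs : Orthonormal ℂ fun n => e (n + 1) := e.orthonormal.comp _ (add_left_injective 1)
  obtain ⟨C', hC'⟩ := exists_norm_le_of_eventually hc
  obtain ⟨W, hW, -⟩ := e.exists_clm hs hC'
  obtain ⟨A, hA, -⟩ := e.exists_clm hs hupp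
  obtain ⟨S, hS⟩ := e.exists_linearIsometry hs
  have hα0 (n : ℕ) : α n ≠ 0 := norm_pos_iff.1 (hε.trans_le (hlow n))
  obtain ⟨D, hD, -⟩ := e.exists_clm (w := fun n => (α n)⁻¹) (C := ε⁻¹) e.orthonormal fun n => by
    rw [norm_inv]
    exact inv_anti₀ hε (hlow n)
  obtain ⟨u, hu⟩ := e.isUnit_one_add_weightedShift hρ0 hρ hc hW
  let T : H →L[ℂ] H := u
  let B : H →L[ℂ] H := ↑u⁻¹
  have hBT : B * T = 1 := u.inv_mul
  have hTB : T * B = 1 := u.mul_inv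
  have hTBx (x : H) : T (B x) = x := DFunLike.congr_fun hTB x
  have hBTx (x : H) : B (T x) = x := DFunLike.congr_fun hBT x
  -- `M` is the shift `A` conjugated by `T = 1 + W`; a left inverse of `A` is conjugated likewise.
  refine ⟨B * A * T, B, T, fun n => ?_, fun n => ?_, hBT,
    B * (D * S.toContinuousLinearMap.adjoint) * T, ?_⟩
  · have := hBTx (e n)
    simpa [T, hu, hW] using this
  · simp [hTBx, hA]
  · have hDA : D * S.toContinuousLinearMap.adjoint * A = 1 := e.clm_ext fun n => by
      have h1 : S.toContinuousLinearMap.adjoint (e (n + 1)) = e n := by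
        rw [← hS n]
        exact DFunLike.congr_fun
          (S.toContinuousLinearMap.isometry_iff_adjoint_comp_self.1 S.isometry) (e n)
      change D (S.toContinuousLinearMap.adjoint (A (e n))) = e n
      simp only [hA, map_smul, h1, hD, smul_smul, mul_inv_cancel₀ (hα0 n), one_smul]
    change B * (D * S.toContinuousLinearMap.adjoint) * T * (B * A * T) = 1
    calc
      _ = B * (D * S.toContinuousLinearMap.adjoint) * (T * B) * A * T := by
        simp only [mul_assoc]
      _ = B * (D * S.toContinuousLinearMap.adjoint * A) * T := by
        rw [hTB, mul_one]
        simp only [mul_assoc]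
      _ = 1 := by rw [hDA, mul_one, hBT]

/-- If `c n * α (n + 1) - α n * c (n + 1)` is a null sequence and the weights are asymptotically
unimodular, then the shift is a compact perturbation of an isometry. -/
theorem isCompactPlusIsometry_of_tendsto
    (hB : ∀ n, B (e n) + c n • B (e (n + 1)) = e n)
    (hM : ∀ n, M (B (e n)) = α n • B (e (n + 1))) (hα0 : ∀ n, α n ≠ 0)
    (hα : Tendsto (fun n => ‖α n‖) atTop (𝓝 1))
    (hβ : Tendsto (fun n => c n * α (n + 1) - α n * c (n + 1)) atTop (𝓝 0)) :
    IsCompactPlusIsometry M := by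
  have hs : Orthonormal ℂ fun n => e (n + 1) := e.orthonormal.comp _ (add_left_injective 1)
  have hs2 : Orthonormal ℂ fun n => e (n + 2) := e.orthonormal.comp _ (add_left_injective 2)
  have hv : Orthonormal ℂ fun n => (α n / ‖α n‖) • e (n + 1) := by
    refine ⟨fun n => ?_, fun i j hij => ?_⟩
    · simp [norm_smul, hα0, e.orthonormal.1]
    · have := hs.2 hij
      simp only [inner_smul_left, inner_smul_right]
      simp [this]
  obtain ⟨V, hV⟩ := e.exists_linearIsometry hv
  have hδ : Tendsto (fun n => α n - α n / ‖α n‖) atTop (𝓝 0) := by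
    rw [tendsto_zero_iff_norm_tendsto_zero]
    have : Tendsto (fun n => |‖α n‖ - 1|) atTop (𝓝 0) := by
      simpa using (hα.sub_const 1).abs
    refine this.congr fun n => ?_
    have hn : (‖α n‖ : ℂ) ≠ 0 := by simpa using hα0 n
    have : α n - α n / ‖α n‖ = α n / ‖α n‖ * ((‖α n‖ - 1 : ℝ) : ℂ) := by
      push_cast
      field_simp
    rw [this, norm_mul, Complex.norm_real, Real.norm_eq_abs]
    simp [hα0]
  obtain ⟨C₁, hC₁⟩ := hδ.norm.bddAbove_range
  obtain ⟨C₂, hC₂⟩ := hβ.norm.bddAbove_range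
  obtain ⟨K₁, hK₁, -⟩ := e.exists_clm hs fun n => hC₁ ⟨n, rfl⟩
  obtain ⟨K₂, hK₂, -⟩ := e.exists_clm hs2 fun n => hC₂ ⟨n, rfl⟩
  refine ⟨K₁ + B ∘L K₂, V, ?_, e.clm_ext fun n => ?_⟩
  · exact (e.isCompactOperator_of_tendsto_zero hs hδ hK₁).add
      ((e.isCompactOperator_of_tendsto_zero hs2 hβ hK₂).clm_comp B)
  · rw [apply_basis_of_shift_rieszBasis hB hM n]
    simp only [add_apply, ContinuousLinearMap.comp_apply, hK₁, hK₂, map_smul,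
      LinearIsometry.coe_toContinuousLinearMap, hV]
    module

theorem tendsto_of_isCompactPlusIsometry {ρ ε : ℝ} (hρ : ρ < 1)
    (hc : ∀ᶠ n in atTop, ‖c n‖ ≤ ρ) (hB : ∀ n, B (e n) + c n • B (e (n + 1)) = e n)
    (hM : ∀ n, M (B (e n)) = α n • B (e (n + 1))) (hε : 0 < ε) (hlow : ∀ n, ε ≤ ‖α n‖)
    (h : IsCompactPlusIsometry M) :
    Tendsto (fun n => ‖α n‖) atTop (𝓝 1) ∧
      Tendsto (fun n => c n * α (n + 1) - α n * c (n + 1)) atTop (𝓝 0) := by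
  obtain ⟨K, V, hK, hKV⟩ := h
  set β : ℕ → ℂ := fun n => c n * α (n + 1) - α n * c (n + 1) with hβdef
  have hMe (n : ℕ) : M (e n) = α n • e (n + 1) + β n • B (e (n + 2)) :=
    apply_basis_of_shift_rieszBasis hB hM n
  have hs : Orthonormal ℂ fun n => e (n + 1) := e.orthonormal.comp _ (add_left_injective 1)
  have he1 (n : ℕ) : ‖e n‖ ≤ 1 := (e.orthonormal.1 n).le
  have hBe (n : ℕ) : ‖B (e n)‖ ≤ ‖B‖ := by simpa [e.orthonormal.1] using B.le_opNorm (e n)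
  have hKe := hK.tendsto_orthonormal e.orthonormal
  have hKB : Tendsto (fun n => K (B (e (n + 1)))) atTop (𝓝 0) :=
    IsCompactOperator.tendsto_orthonormal (K := K ∘L B) (hK.comp_clm B) hs
  have hβ : Tendsto β atTop (𝓝 0) := by
    -- The inner product of the images is `α (n+1) * conj (β n) * ‖B (e (n+2))‖ ^ 2`, whose modulus
    -- is at least `ε * ‖β n‖`.
    have h1 := tendsto_inner_sub_inner hKV he1 (fun n => hBe (n + 1)) hKe hKB
    refine squeeze_zero_norm (fun n => ?_) (by simpa using h1.norm.const_mul ε⁻¹)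
    rw [inner_rieszBasis_eq_zero hρ hc hB, sub_zero, hM, hMe, inner_smul_right, inner_add_left,
      inner_smul_left, inner_smul_left, inner_rieszBasis_eq_zero hρ hc hB, mul_zero, zero_add,
      inner_self_eq_norm_sq_to_K, norm_mul, norm_mul, RCLike.norm_conj, ← div_eq_inv_mul,
      le_div_iff₀ hε]
    have hg : 1 ≤ ‖((‖B (e (n + 2))‖ : ℂ)) ^ 2‖ := by
      simpa using one_le_pow₀ (one_le_norm_rieszBasis hρ hc hB (n + 2)) (n := 2)
    calc ‖β n‖ * ε ≤ ‖β n‖ * ‖α (n + 1)‖ := by gcongr; exact hlow _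
      _ = ‖α (n + 1)‖ * (‖β n‖ * 1) := by ring
      _ ≤ _ := by gcongr; exact hg
  refine ⟨?_, hβ⟩
  have h2 : Tendsto (fun n => M (e n) - β n • B (e (n + 2)) - K (e n) - V (e n)) atTop (𝓝 0) := by
    have h3 : Tendsto (fun n => β n • B (e (n + 2))) atTop (𝓝 0) := by
      refine squeeze_zero_norm (a := fun n => ‖β n‖ * ‖B‖) (fun n => ?_)
        (by simpa using hβ.norm.mul_const ‖B‖)
      rw [norm_smul]
      exact mul_le_mul_of_nonneg_left (hBe _) (norm_nonneg _)
    refine (by simpa using h3.neg : Tendsto (fun n => -(β n • B (e (n + 2)))) atTop (𝓝 0)).congr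
      fun n => ?_
    rw [hKV]
    simp only [add_apply, LinearIsometry.coe_toContinuousLinearMap]
    abel
  have h4 : Tendsto (fun n => α n • e (n + 1) - V (e n)) atTop (𝓝 0) := by
    refine (by simpa using h2.add hKe : Tendsto (fun n =>
      M (e n) - β n • B (e (n + 2)) - K (e n) - V (e n) + K (e n)) atTop (𝓝 0)).congr fun n => ?_
    rw [hMe]
    abel
  rw [tendsto_iff_dist_tendsto_zero]
  refine squeeze_zero (fun _ => dist_nonneg) (fun n => ?_) (by simpa using h4.norm)
  rw [Real.dist_eq]
  have := abs_norm_sub_norm_le (α n • e (n + 1)) (V (e n))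
  simpa [norm_smul, e.orthonormal.1] using this

end WeightedShift

/-! ### Identification of the Riesz basis with monomials. -/

section TridiagonalSpace

variable {H : Type*} [NormedAddCommGroup H] [InnerProductSpace ℂ H]
  [RKHS ℂ H 𝔻 ℂ] {a b : ℕ → ℂ} {e : HilbertBasis ℕ ℂ H}

theorem isCoordinateShift_of_rieszBasis {M B T : H →L[ℂ] H}
    (ha : ∀ n, a n ≠ 0) (hBe : ∀ (n : ℕ) (z : 𝔻), (B (e n)) z = a n * (z : ℂ) ^ n)
    (hM : ∀ n, M (B (e n)) = (a n / a (n + 1)) • B (e (n + 1))) (hBT : B * T = 1) :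
    IsCoordinateShift M := by
  intro f z
  let φ : H →L[ℂ] ℂ := ContinuousLinearMap.proj z ∘L RKHS.coeCLM ℂ
  have hφ (g : H) : φ g = g z := rfl
  -- Checking on the range of `B` suffices, since `B * T = 1` makes `B` surjective.
  have h : φ ∘L M ∘L B = (z : ℂ) • φ ∘L B := e.clm_ext fun n => by
    simp only [ContinuousLinearMap.comp_apply, smul_apply, hM, hφ, RKHS.coe_smul,
      Pi.smul_apply, hBe, smul_eq_mul]
    rw [← mul_assoc, div_mul_cancel₀ _ (ha _)]
    ring
  have hf : B (T f) = f := DFunLike.congr_fun hBT f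
  have := DFunLike.congr_fun h (T f)
  simpa [hφ, hf] using this

variable [CompleteSpace H]

/-- The monomials `a n * z ^ n` are bounded in `n`: each is the mean of the values of the `n`-th
basis function at `z` and, up to sign, at `-z`. -/
theorem exists_norm_mul_pow_le (he : ∀ (n : ℕ) (z : 𝔻), (e n) z = tridiagonalFun a b n z) (z : 𝔻) :
    ∃ C : ℝ, ∀ n, ‖a n * (z : ℂ) ^ n‖ ≤ C := by
  refine ⟨(√‖RKHS.kernel H z z‖ + √‖RKHS.kernel H (-z) (-z)‖) / 2, fun n => ?_⟩
  have h1 (w : 𝔻) : ‖tridiagonalFun a b n w‖ ≤ √‖RKHS.kernel H w w‖ := by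
    simpa [e.orthonormal.1, he] using RKHS.norm_apply_le (e n) w
  have h2 : 2 * (a n * (z : ℂ) ^ n) =
      tridiagonalFun a b n z + (-1) ^ n * tridiagonalFun a b n (-z) := by
    have hs : ((-1 : ℂ)) ^ n * (-1) ^ n = 1 := by rw [← mul_pow]; simp
    simp only [tridiagonalFun, Complex.UnitDisc.coe_neg, neg_pow (z : ℂ)]
    linear_combination (-(a n - b n * z) * (z : ℂ) ^ n) * hs
  have h3 : ‖2 * (a n * (z : ℂ) ^ n)‖ ≤ √‖RKHS.kernel H z z‖ + √‖RKHS.kernel H (-z) (-z)‖ := by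
    rw [h2]
    refine (norm_add_le _ _).trans (add_le_add (h1 z) ?_)
    simpa using h1 (-z)
  rw [norm_mul, RCLike.norm_ofNat] at h3
  linarith

/-- Both sides satisfy the same backward recursion and are bounded in `n` at fixed `z`, so their
difference vanishes. -/
theorem rieszBasis_apply_eq {B : H →L[ℂ] H} {ρ : ℝ} (hρ : ρ < 1) (ha : ∀ n, a n ≠ 0)
    (he : ∀ (n : ℕ) (z : 𝔻), (e n) z = tridiagonalFun a b n z)
    (hc : ∀ᶠ n in atTop, ‖b n / a (n + 1)‖ ≤ ρ)
    (hB : ∀ n, B (e n) + (b n / a (n + 1)) • B (e (n + 1)) = e n) (n : ℕ) (z : 𝔻) :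
    (B (e n)) z = a n * (z : ℂ) ^ n := by
  obtain ⟨C, hC⟩ := exists_norm_mul_pow_le he z
  refine sub_eq_zero.1 (eq_zero_of_bounded_backward_recursion
    (h := fun n => (B (e n)) z - a n * (z : ℂ) ^ n) (C := ‖B‖ * √‖RKHS.kernel H z z‖ + C)
    hρ hc (fun n => ?_) (fun n => ?_) n)
  · refine (norm_sub_le _ _).trans (add_le_add ?_ (hC n))
    refine (RKHS.norm_apply_le _ z).trans (mul_le_mul_of_nonneg_right ?_ (Real.sqrt_nonneg _))
    simpa [e.orthonormal.1] using B.le_opNorm (e n)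
  · have h := congrArg (fun f : H => f z) (hB n)
    simp only [RKHS.coe_add, RKHS.coe_smul, Pi.add_apply, Pi.smul_apply, smul_eq_mul, he,
      tridiagonalFun] at h
    have h' : b n / a (n + 1) * a (n + 1) = b n := div_mul_cancel₀ _ (ha _)
    linear_combination h - (z : ℂ) ^ (n + 1) * h'

end TridiagonalSpace

theorem exists_eventually_norm_le_of_limsup_enorm_lt_one {E : Type*} [SeminormedAddCommGroup E]
    {c : ℕ → E} (h : limsup (fun n => ‖c n‖ₑ) atTop < 1) :
    ∃ ρ : ℝ, 0 < ρ ∧ ρ < 1 ∧ ∀ᶠ n in atTop, ‖c n‖ ≤ ρ := by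
  obtain ⟨r, hr, hr1⟩ := ENNReal.lt_iff_exists_nnreal_btwn.1 h
  refine ⟨r, ?_, ?_, (eventually_lt_of_limsup_lt hr).mono fun n hn => ?_⟩
  · exact_mod_cast pos_of_gt hr
  · exact_mod_cast hr1
  · rw [enorm_eq_nnnorm] at hn
    exact_mod_cast hn.le

/-- A null sequence stays null after multiplication by a bounded sequence. -/
theorem tendsto_zero_mul_of_norm_le {w d : ℕ → ℂ} {C : ℝ} (hw : ∀ n, ‖w n‖ ≤ C)
    (hd : Tendsto d atTop (𝓝 0)) : Tendsto (fun n => w n * d n) atTop (𝓝 0) :=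
  squeeze_zero_norm (a := fun n => C * ‖d n‖)
    (fun n => (norm_mul_le _ _).trans (mul_le_mul_of_nonneg_right (hw n) (norm_nonneg _)))
    (by simpa using hd.norm.const_mul C)

theorem theorem1p2 {H : Type*} [NormedAddCommGroup H] [InnerProductSpace ℂ H] [CompleteSpace H]
    [RKHS ℂ H 𝔻 ℂ] (a b : ℕ → ℂ) (ha : ∀ n, a n ≠ 0)
    (e : HilbertBasis ℕ ℂ H) (he : ∀ (n : ℕ) (z : 𝔻), (e n) z = tridiagonalFun a b n z)
    (hlow : ∃ ε : ℝ, 0 < ε ∧ ∀ n, ε ≤ ‖a n / a (n + 1)‖)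
    (hupp : ∃ C : ℝ, ∀ n, ‖a n / a (n + 1)‖ ≤ C)
    (hlim : limsup (fun n => ‖b n / a (n + 1)‖ₑ) atTop < 1) :
    ∃ M : H →L[ℂ] H, IsCoordinateShift M ∧ IsLeftInvertible M ∧
      (IsCompactPlusIsometry M ↔
        Tendsto (fun n => ‖a n / a (n + 1)‖) atTop (𝓝 1) ∧
        Tendsto (fun n => ‖b n / a n - b (n + 1) / a (n + 1)‖) atTop (𝓝 0)) := by
  obtain ⟨ε, hε, hlow⟩ := hlow
  obtain ⟨C, hupp⟩ := hupp
  obtain ⟨ρ, hρ0, hρ, hc⟩ := exists_eventually_norm_le_of_limsup_enorm_lt_one hlim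
  obtain ⟨M, B, T, hB, hM, hBT, hL⟩ :=
    e.exists_shift_rieszBasis (α := fun n => a n / a (n + 1)) hρ0 hρ hc hε hlow hupp
  refine ⟨M, isCoordinateShift_of_rieszBasis ha (rieszBasis_apply_eq hρ ha he hc hB) hM hBT, hL, ?_⟩
  have hα0 (n : ℕ) : a n / a (n + 1) ≠ 0 := div_ne_zero (ha _) (ha _)
  -- The factor `α n * α (n+1)` is bounded above and away from zero, so the two null conditions are
  -- equivalent.
  have hβd (n : ℕ) : b n / a (n + 1) * (a (n + 1) / a (n + 1 + 1)) -
      a n / a (n + 1) * (b (n + 1) / a (n + 1 + 1)) =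
      a n / a (n + 1) * (a (n + 1) / a (n + 1 + 1)) * (b n / a n - b (n + 1) / a (n + 1)) := by
    have := ha n
    have := ha (n + 1)
    have := ha (n + 1 + 1)
    field_simp
  rw [← tendsto_zero_iff_norm_tendsto_zero]
  constructor
  · intro h
    obtain ⟨h1, h2⟩ := tendsto_of_isCompactPlusIsometry hρ hc hB hM hε hlow h
    refine ⟨h1, ?_⟩
    have hw (n : ℕ) : ‖(a n / a (n + 1) * (a (n + 1) / a (n + 1 + 1)))⁻¹‖ ≤ (ε * ε)⁻¹ := by
      rw [norm_inv, norm_mul]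
      exact inv_anti₀ (mul_pos hε hε) (mul_le_mul (hlow n) (hlow (n + 1)) hε.le (norm_nonneg _))
    refine (tendsto_zero_mul_of_norm_le hw h2).congr fun n => ?_
    rw [hβd, inv_mul_cancel_left₀ (mul_ne_zero (hα0 n) (hα0 (n + 1)))]
  · rintro ⟨h1, h2⟩
    refine isCompactPlusIsometry_of_tendsto hB hM hα0 h1 ?_
    have hw (n : ℕ) : ‖a n / a (n + 1) * (a (n + 1) / a (n + 1 + 1))‖ ≤ C * C := by
      rw [norm_mul]
      exact mul_le_mul (hupp n) (hupp (n + 1)) (norm_nonneg _) ((norm_nonneg _).trans (hupp n))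
    exact (tendsto_zero_mul_of_norm_le hw h2).congr fun n => (hβd n).symm
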